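/- A Hilbert algebra is an algebra $(H,\to,1)$ with $a\to(b\to a)=1$, $(a\to(b\to c))\to((a\to b)\to(a\to c))=1$, and $a=b$ whenever $a\to b=b\to a=1$; its natural order is $a\le b\iff a\to b=1$. It is prelinear if $((a\to b)\to c)\to(((b\to a)\to c)\to c)=1$ for all $a,b,c$, and bounded if it has a constant $0$ that is its least element. Let $\mathrm{PHil}_0$ be the category of bounded prelinear Hilbert algebras and homomorphisms (preserving $\to,1,0$). In a poset write $[M)$ for the upset generated by $M$, $[x)=[\{x\})$, $(x]=\{y: y\le x\}$, and $U^m$ for the set of minimal elements of $U$. A finite forest is a finite poset in which every $(x]$ is a chain. An $h$-base of a finite forest is a family $\mathcal B$ of upsets such that $[x)\in\mathcal B$ for all $x$, and $[M)\in\mathcal B$ whenever $M\subseteq U^m$ with $U\in\mathcal B$. Objects of $\mathrm{hFor}$ are triples $(X,\le,\mathcal B_X)$ with $(X,\le)$ a finite forest, $\mathcal B_X$ an $h$-base of it and $X\in\mathcal B_X$; morphisms $f:X\to Y$ are the order-preserving maps such that $y\le f(x)$ implies $y=f(z)$ for some $z\le x$, and $f^{-1}(U)\in\mathcal B_X$ for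 all $U\in\mathcal B_Y$. For a finite $H\in\mathrm{PHil}_0$ let $X(H)\in\mathrm{hFor}$ be the set of irreducible implicative filters of $H$ ordered by reverse inclusion, with $h$-base $\{\varphi_H(a)^c: a\in H\}$, where $\varphi_H(a)=\{P: a\in P\}$. (An implicative filter is a set $F\ni 1$ with $b\in F$ whenever $a,\,a\to b\in F$; it is irreducible if it is proper and is not the intersection of two implicative filters both different from it.) For $X\in\mathrm{hFor}$ let $D(X)=\{U\subseteq X: U^c\in\mathcal B_X\}\in\mathrm{PHil}_0$, with $U\Rightarrow V=[U\cap V^c)^c$, $1=X$, $0=\emptyset$; for a morphism $f:X\to Y$ let $D(f):D(Y)\to D(X)$, $U\mapsto f^{-1}(U)$. For $X,Y\in\mathrm{hFor}$ let $X\otimes Y$ be the set of all sets $p=\{p_0<\dots<p_k\}\subseteq X\times Y$ with $p_0$ minimal in $X\times Y$, $\pi_1(p)=(\pi_1(p_k)]$ and $\pi_2(p)=(\pi_2(p_k)]$, ordered by: $p\preceq q$ iff $p$ is an initial segment of $q$. Put $\overline{\pi_i}(p)=\pi_i(p_k)$. Let $\mathcal B_X\otimes\mathcal B_Y$ consist of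 the sets $[u)$ with $u\in X\otimes Y$, the sets $[T)$ with $T\subseteq(\overline{\pi_1}^{-1}(V))^m$, $V\in\mathcal B_X$, and the sets $[T)$ with $T\subseteq(\overline{\pi_2}^{-1}(V))^m$, $V\in\mathcal B_Y$. Then $(X\otimes Y,\preceq,\mathcal B_X\otimes\mathcal B_Y)\in\mathrm{hFor}$, and $\overline{\pi_1},\overline{\pi_2}$ are morphisms of $\mathrm{hFor}$. **Theorem.** $\mathrm{PHil}_0$ is locally finite: in every bounded prelinear Hilbert algebra, the subalgebra generated by a finite set is finite. If $H$ and $G$ are finite algebras in $\mathrm{PHil}_0$, then the algebra $D(X(H)\otimes X(G))$ is finite and, together with the homomorphisms $$j_H=D(\overline{\pi_1})\circ\varphi_H: H\to D(X(H)\otimes X(G)),\qquad j_G=D(\overline{\pi_2})\circ\varphi_G: G\to D(X(H)\otimes X(G)),$$ it is the coproduct of $H$ and $G$ in $\mathrm{PHil}_0$: for every (possibly infinite) $K\in\mathrm{PHil}_0$ and all homomorphisms $f:H\to K$, $g:G\to K$ there is a unique homomorphism $h:D(X(H)\otimes X(G))\to K$ with $h\circ j_H=f$ and $h\circ j_G=g$.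 -/

import Mathlib

open CategoryTheory CategoryTheory.Limits

universe u

/-! ### Hilbert algebras -/

/-- A Hilbert algebra `(H, →, 1)`; implication is written `⇨` and `1` is written `⊤`. -/
class HilbertAlgebra (α : Type u) extends HImp α, Top α where
  imp_imp_left : ∀ a b : α, a ⇨ (b ⇨ a) = ⊤
  imp_distrib : ∀ a b c : α, (a ⇨ (b ⇨ c)) ⇨ ((a ⇨ b) ⇨ (a ⇨ c)) = ⊤
  imp_antisymm : ∀ a b : α, a ⇨ b = ⊤ → b ⇨ a = ⊤ → a = b

/-- A bounded prelinear Hilbert algebra `(H, →, 1, 0)`. The natural order is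
`a ≤ b ↔ a ⇨ b = ⊤`, so `bot_imp` says that `0` (written `⊥`) is the least element. -/
class BoundedPrelinearHilbertAlgebra (α : Type u) extends HilbertAlgebra α, Bot α where
  bot_imp : ∀ a : α, ⊥ ⇨ a = ⊤
  prelinear : ∀ a b c : α, ((a ⇨ b) ⇨ c) ⇨ (((b ⇨ a) ⇨ c) ⇨ c) = ⊤

/-- The category of bounded prelinear Hilbert algebras (objects). -/
structure PHilz : Type (u + 1) where
  carrier : Type u
  [str : BoundedPrelinearHilbertAlgebra carrier]

namespace PHilz

instance : CoeSort PHilz.{u} (Type u) := ⟨PHilz.carrier⟩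

instance (H : PHilz.{u}) : BoundedPrelinearHilbertAlgebra H := H.str

/-- Algebra homomorphisms of type `(2, 0, 0)`. -/
@[ext]
structure Hom (H G : PHilz.{u}) where
  toFun : H → G
  map_imp : ∀ a b : H, toFun (a ⇨ b) = toFun a ⇨ toFun b
  map_top : toFun ⊤ = ⊤
  map_bot : toFun ⊥ = ⊥

instance : Category PHilz.{u} where
  Hom := Hom
  id H := ⟨fun a => a, fun _ _ => rfl, rfl, rfl⟩
  comp f g := ⟨fun a => g.toFun (f.toFun a),
    fun a b => by rw [f.map_imp, g.map_imp],
    by rw [f.map_top, g.map_top], by rw [f.map_bot, g.map_bot]⟩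

/-- The (universe of the) subalgebra of `K` generated by `S`. -/
inductive Generated {K : PHilz.{u}} (S : Set K) : K → Prop
  | of (a : K) (ha : a ∈ S) : Generated S a
  | top : Generated S ⊤
  | bot : Generated S ⊥
  | imp (a b : K) (ha : Generated S a) (hb : Generated S b) : Generated S (a ⇨ b)

end PHilz

/-! ### Implicative filters -/

section Filters

variable {α : Type u} [HilbertAlgebra α]

/-- Implicative filters. -/
def IsImplicativeFilter (F : Set α) : Prop :=
  ⊤ ∈ F ∧ ∀ a b : α, a ∈ F → a ⇨ b ∈ F → b ∈ F

/-- Irreducible implicative filters. -/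
def IsIrreducibleFilter (F : Set α) : Prop :=
  IsImplicativeFilter F ∧ F ≠ Set.univ ∧
    ∀ F₁ F₂ : Set α, IsImplicativeFilter F₁ → IsImplicativeFilter F₂ → F = F₁ ∩ F₂ →
      F = F₁ ∨ F = F₂

namespace HilbertAlgebra

theorem top_mp {e : α} (h : ⊤ ⇨ e = ⊤) : e = ⊤ := by
  refine imp_antisymm _ _ ?_ h
  have := imp_imp_left e (⊤ : α)
  rwa [h] at this

theorem mp {a b : α} (ha : a = ⊤) (h : a ⇨ b = ⊤) : b = ⊤ := top_mp (ha ▸ h)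

theorem self_imp (a : α) : a ⇨ a = ⊤ :=
  mp (imp_imp_left a a) (mp (imp_imp_left a (a ⇨ a)) (imp_distrib a (a ⇨ a) a))

end HilbertAlgebra

open HilbertAlgebra

theorem IsImplicativeFilter.imp_mem {F : Set α} (hF : IsImplicativeFilter F) {a : α} (b : α)
    (ha : a ∈ F) : b ⇨ a ∈ F :=
  hF.2 _ _ ha (by rw [imp_imp_left]; exact hF.1)

/-- The implicative filter generated by a filter and one more element. -/
theorem IsImplicativeFilter.extend {F : Set α} (hF : IsImplicativeFilter F) (a : α) :
    IsImplicativeFilter {x | a ⇨ x ∈ F} ∧ F ⊆ {x | a ⇨ x ∈ F} ∧ a ∈ {x | a ⇨ x ∈ F} := by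
  refine ⟨⟨hF.imp_mem a hF.1, fun x y hx hxy => ?_⟩, fun x hx => hF.imp_mem a hx, ?_⟩
  · exact hF.2 _ _ hx (hF.2 _ _ hxy (by rw [imp_distrib]; exact hF.1))
  · change a ⇨ a ∈ F
    rw [self_imp]; exact hF.1

theorem exists_irreducible [Finite α] {F : Set α} (hF : IsImplicativeFilter F) {b : α}
    (hb : b ∉ F) : ∃ P, IsIrreducibleFilter P ∧ F ⊆ P ∧ b ∉ P := by
  obtain ⟨P, hFP, hP⟩ := (Set.toFinite {F' : Set α | IsImplicativeFilter F' ∧ b ∉ F'}).exists_le_maximal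
    (show F ∈ {F' : Set α | IsImplicativeFilter F' ∧ b ∉ F'} from ⟨hF, hb⟩)
  refine ⟨P, ⟨hP.1.1, fun h => hP.1.2 (h ▸ Set.mem_univ b), fun F₁ F₂ h₁ h₂ h => ?_⟩, hFP, hP.1.2⟩
  by_cases hb₁ : b ∈ F₁
  · by_cases hb₂ : b ∈ F₂
    · exact absurd (h ▸ ⟨hb₁, hb₂⟩ : b ∈ P) hP.1.2
    · have hs : P ⊆ F₂ := h ▸ Set.inter_subset_right
      exact Or.inr (Set.Subset.antisymm hs (hP.2 ⟨h₂, hb₂⟩ hs))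
  · have hs : P ⊆ F₁ := h ▸ Set.inter_subset_left
    exact Or.inl (Set.Subset.antisymm hs (hP.2 ⟨h₁, hb₁⟩ hs))

/-- `a ⇨ b ∈ P` in terms of the irreducible filters above `P`. -/
theorem imp_mem_iff [Finite α] {P : Set α} (hP : IsImplicativeFilter P) (a b : α) :
    a ⇨ b ∈ P ↔ ∀ Q, IsIrreducibleFilter Q → P ⊆ Q → a ∈ Q → b ∈ Q := by
  refine ⟨fun h Q hQ hPQ ha => hQ.1.2 _ _ ha (hPQ h), fun h => ?_⟩
  by_contra hab
  obtain ⟨h1, h2, h3⟩ := hP.extend a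
  obtain ⟨Q, hQ, hs, hb⟩ := exists_irreducible h1 (b := b) hab
  exact hb (h Q hQ (h2.trans hs) (hs h3))

theorem exists_imp_list [Finite α] (c : α) (l : List α) :
    ∃ b : α, ∀ Q : Set α, IsImplicativeFilter Q →
      (b ∉ Q ↔ ∃ R, IsIrreducibleFilter R ∧ Q ⊆ R ∧ (∀ x ∈ l, x ∈ R) ∧ c ∉ R) := by
  induction l with
  | nil =>
    refine ⟨c, fun Q hQ => ⟨fun h => ?_, ?_⟩⟩
    · obtain ⟨R, hR, hs, hc⟩ := exists_irreducible hQ h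
      exact ⟨R, hR, hs, by simp, hc⟩
    · rintro ⟨R, -, hs, -, hc⟩ h
      exact hc (hs h)
  | cons y l ih =>
    obtain ⟨b, hb⟩ := ih
    refine ⟨y ⇨ b, fun Q hQ => ?_⟩
    obtain ⟨h1, h2, h3⟩ := hQ.extend y
    have := hb _ h1
    rw [show (y ⇨ b ∉ Q ↔ b ∉ {x | y ⇨ x ∈ Q}) from Iff.rfl, this]
    constructor
    · rintro ⟨R, hR, hs, hl, hc⟩
      exact ⟨R, hR, h2.trans hs, by simpa using ⟨hs h3, hl⟩, hc⟩
    · rintro ⟨R, hR, hs, hl, hc⟩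
      have hl' : y ∈ R ∧ ∀ x ∈ l, x ∈ R := by simpa using hl
      exact ⟨R, hR, fun x hx => hR.1.2 _ _ hl'.1 (hs hx), hl'.2, hc⟩

theorem exists_imp_set [Finite α] (c : α) (S : Set α) :
    ∃ b : α, ∀ Q : Set α, IsImplicativeFilter Q →
      (b ∉ Q ↔ ∃ R, IsIrreducibleFilter R ∧ Q ⊆ R ∧ S ⊆ R ∧ c ∉ R) := by
  obtain ⟨b, hb⟩ := exists_imp_list c (Set.toFinite S).toFinset.toList
  refine ⟨b, fun Q hQ => (hb Q hQ).trans ?_⟩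
  simp [Set.subset_def]

theorem exists_common_bound [Finite α] {P : Set α} (hP : IsIrreducibleFilter P) :
    ∃ c ∉ P, ∀ b ∉ P, b ⇨ c ∈ P := by
  have key : ∀ T : Set α, T.Finite → ∃ c ∉ P, ∀ b ∈ T, b ∉ P → b ⇨ c ∈ P := by
    intro T hT
    induction T, hT using Set.Finite.induction_on with
    | empty =>
      obtain ⟨c, hc⟩ := (Set.ne_univ_iff_exists_notMem P).1 hP.2.1
      exact ⟨c, hc, by simp⟩
    | @insert a T _ _ ih =>
      obtain ⟨c, hc, hT⟩ := ih
      by_cases ha : a ∈ P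
      · refine ⟨c, hc, fun b hb hbP => ?_⟩
        rcases hb with rfl | hb
        · exact absurd ha hbP
        · exact hT b hb hbP
      · obtain ⟨a1, a2, a3⟩ := hP.1.extend a
        obtain ⟨c1, c2, c3⟩ := hP.1.extend c
        have hne : P ≠ {x | a ⇨ x ∈ P} ∩ {x | c ⇨ x ∈ P} := by
          intro h
          rcases hP.2.2 _ _ a1 c1 h with h | h
          · exact ha (by rw [h]; exact a3)
          · exact hc (by rw [h]; exact c3)
        have hex : ∃ d, (a ⇨ d ∈ P ∧ c ⇨ d ∈ P) ∧ d ∉ P := by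
          by_contra hcon
          push Not at hcon
          exact hne (Set.Subset.antisymm (fun x hx => ⟨a2 hx, c2 hx⟩) fun x hx => hcon x hx)
        obtain ⟨d, ⟨had, hcd⟩, hd⟩ := hex
        refine ⟨d, hd, fun b hb hbP => ?_⟩
        rcases hb with rfl | hb
        · exact had
        · obtain ⟨e1, e2, e3⟩ := hP.1.extend b
          exact e1.2 c d (hT b hb hbP) (e2 hcd)
  obtain ⟨c, hc, h⟩ := key Set.univ Set.finite_univ
  exact ⟨c, hc, fun b hb => h b (Set.mem_univ b) hb⟩

theorem exists_cone [Finite α] {P : Set α} (hP : IsIrreducibleFilter P) :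
    ∃ a : α, ∀ Q, IsImplicativeFilter Q → (a ∉ Q ↔ Q ⊆ P) := by
  obtain ⟨c, hc, h⟩ := exists_common_bound hP
  obtain ⟨a, ha⟩ := exists_imp_set c P
  refine ⟨a, fun Q hQ => (ha Q hQ).trans ⟨?_, fun hs => ⟨P, hP, hs, subset_rfl, hc⟩⟩⟩
  rintro ⟨R, hR, hs, hPR, hcR⟩ b hb
  by_contra hbP
  exact hcR (hR.1.2 _ _ (hs hb) (hPR (h b hbP)))

end Filters

/-! ### Finite forests with an `h`-base -/

/-- An `h`-base of a poset `F` (used for finite forests): a family of upsets that contains all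
principal upsets `[x)` and contains `[M)` whenever `M` is a set of minimal elements of one of
its members. -/
structure IsHBase {F : Type u} [PartialOrder F] (B : Set (Set F)) : Prop where
  upper : ∀ U ∈ B, IsUpperSet U
  cone_mem : ∀ x : F, Set.Ici x ∈ B
  minimal_mem : ∀ U ∈ B, ∀ M : Set F, M ⊆ {x | Minimal (· ∈ U) x} →
    (upperClosure M : Set F) ∈ B

/-- Finite forests (posets in which every `(x]` is a chain) with an `h`-base to which the whole
forest belongs. -/
structure HFor : Type (u + 1) where
  carrier : Type u
  [order : PartialOrder carrier]
  [finite : Finite carrier]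
  forest : ∀ x : carrier, IsChain (· ≤ ·) (Set.Iic x)
  base : Set (Set carrier)
  isHBase : IsHBase base
  univ_mem : Set.univ ∈ base

namespace HFor

instance : CoeSort HFor.{u} (Type u) := ⟨HFor.carrier⟩

instance (X : HFor.{u}) : PartialOrder X := X.order

instance (X : HFor.{u}) : Finite X := X.finite

/-- Order preserving open maps for which preimages of basic sets are basic. -/
@[ext]
structure Hom (X Y : HFor.{u}) where
  toFun : X → Y
  monotone : Monotone toFun
  isOpen : ∀ (x : X) (y : Y), y ≤ toFun x → ∃ z ≤ x, toFun z = y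
  preimage_mem : ∀ U ∈ Y.base, toFun ⁻¹' U ∈ X.base

instance : Category HFor.{u} where
  Hom := Hom
  id X := ⟨fun x => x, fun _ _ h => h, fun _ y h => ⟨y, h, rfl⟩, fun _ h => h⟩
  comp f g := ⟨fun x => g.toFun (f.toFun x), fun _ _ h => g.monotone (f.monotone h),
    fun x y h => by
      obtain ⟨z, hz, rfl⟩ := g.isOpen _ _ h
      obtain ⟨w, hw, rfl⟩ := f.isOpen _ _ hz
      exact ⟨w, hw, rfl⟩,
    fun U hU => f.preimage_mem _ (g.preimage_mem U hU)⟩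

theorem exists_minimal_le {X : Type u} [PartialOrder X] [Finite X] {U : Set X} {x : X}
    (hx : x ∈ U) : ∃ m ≤ x, Minimal (· ∈ U) m :=
  (Set.toFinite U).exists_le_minimal hx

/-! ### The dual algebra of an object of `HFor` -/

/-- The universe of the dual algebra: complements of basic sets. -/
structure DualCarrier (X : HFor.{u}) : Type u where
  set : Set X
  compl_mem : setᶜ ∈ X.base

@[ext]
theorem DualCarrier.ext {X : HFor.{u}} {U V : DualCarrier X} (h : U.set = V.set) : U = V := by
  cases U; cases V; cases h; rfl

theorem DualCarrier.lower {X : HFor.{u}} (U : DualCarrier X) {x y : X} (hx : x ∈ U.set)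
    (h : y ≤ x) : y ∈ U.set := by
  by_contra hy
  exact X.isHBase.upper _ U.compl_mem h hy hx

/-- The implication `U ⇒ V = [U ∩ Vᶜ)ᶜ`. -/
def DualCarrier.imp {X : HFor.{u}} (U V : DualCarrier X) : DualCarrier X where
  set := (upperClosure (U.set ∩ V.setᶜ) : Set X)ᶜ
  compl_mem := by
    rw [compl_compl]
    have : (upperClosure (U.set ∩ V.setᶜ) : Set X) =
        upperClosure {x | Minimal (· ∈ V.setᶜ) x ∧ x ∈ U.set} := by
      ext x
      simp only [SetLike.mem_coe, mem_upperClosure]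
      constructor
      · rintro ⟨y, ⟨hyU, hyV⟩, hyx⟩
        obtain ⟨m, hm, hmin⟩ := exists_minimal_le hyV
        exact ⟨m, ⟨hmin, U.lower hyU hm⟩, hm.trans hyx⟩
      · rintro ⟨y, ⟨hyV, hyU⟩, hyx⟩
        exact ⟨y, ⟨hyU, hyV.1⟩, hyx⟩
    rw [this]
    exact X.isHBase.minimal_mem _ V.compl_mem _ fun x hx => hx.1

theorem DualCarrier.mem_imp {X : HFor.{u}} (U V : DualCarrier X) (x : X) :
    x ∈ (U.imp V).set ↔ ∀ y ≤ x, y ∈ U.set → y ∈ V.set := by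
  simp only [DualCarrier.imp, Set.mem_compl_iff, SetLike.mem_coe, mem_upperClosure,
    Set.mem_inter_iff]
  constructor
  · intro h y hy hU
    by_contra hV
    exact h ⟨y, ⟨hU, hV⟩, hy⟩
  · rintro h ⟨y, ⟨hU, hV⟩, hy⟩
    exact hV (h y hy hU)

theorem DualCarrier.eq_univ_iff {X : HFor.{u}} (U V : DualCarrier X) :
    (U.imp V).set = Set.univ ↔ U.set ⊆ V.set := by
  rw [Set.eq_univ_iff_forall]
  constructor
  · intro h x hx
    exact (U.mem_imp V x).1 (h x) x le_rfl hx
  · intro h x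
    exact (U.mem_imp V x).2 fun y _ hy => h hy

/-- The bounded prelinear Hilbert algebra of complements of basic sets, with implication
`U ⇒ V = [U ∩ Vᶜ)ᶜ`, unit the whole forest and zero the empty set. -/
instance (X : HFor.{u}) : BoundedPrelinearHilbertAlgebra (DualCarrier X) where
  himp := DualCarrier.imp
  top := ⟨Set.univ, by
    have h := X.isHBase.minimal_mem _ X.univ_mem ∅ (Set.empty_subset _)
    simpa using h⟩
  bot := ⟨∅, by simpa using X.univ_mem⟩
  imp_imp_left U V := by
    apply DualCarrier.ext
    change (U.imp (V.imp U)).set = Set.univ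
    rw [DualCarrier.eq_univ_iff]
    intro x hx
    rw [DualCarrier.mem_imp]
    exact fun y hy _ => U.lower hx hy
  imp_distrib U V W := by
    apply DualCarrier.ext
    change ((U.imp (V.imp W)).imp ((U.imp V).imp (U.imp W))).set = Set.univ
    rw [DualCarrier.eq_univ_iff]
    intro x hx
    simp only [DualCarrier.mem_imp] at hx ⊢
    exact fun y hy h z hz hU => hx z (hz.trans hy) hU z le_rfl (h z hz hU)
  imp_antisymm U V h₁ h₂ := by
    have h₁' : (U.imp V).set = Set.univ := congrArg DualCarrier.set h₁
    have h₂' : (V.imp U).set = Set.univ := congrArg DualCarrier.set h₂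
    rw [DualCarrier.eq_univ_iff] at h₁' h₂'
    exact DualCarrier.ext (Set.Subset.antisymm h₁' h₂')
  bot_imp U := by
    apply DualCarrier.ext
    change (DualCarrier.imp _ U).set = Set.univ
    rw [DualCarrier.eq_univ_iff]
    exact Set.empty_subset _
  prelinear U V W := by
    apply DualCarrier.ext
    change (((U.imp V).imp W).imp (((V.imp U).imp W).imp W)).set = Set.univ
    rw [DualCarrier.eq_univ_iff]
    intro x hx
    simp only [DualCarrier.mem_imp] at hx ⊢
    intro y hy h
    by_contra hW
    have h1 : ¬ ∀ z ≤ y, z ∈ U.set → z ∈ V.set := fun h' => hW (hx y hy h')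
    have h2 : ¬ ∀ z ≤ y, z ∈ V.set → z ∈ U.set := fun h' => hW (h y le_rfl h')
    push Not at h1 h2
    obtain ⟨z, hz, hzU, hzV⟩ := h1
    obtain ⟨w, hw, hwV, hwU⟩ := h2
    rcases (X.forest y).total hz hw with hzw | hwz
    · exact hzV (V.lower hwV hzw)
    · exact hwU (U.lower hzU hwz)

/-- The dual algebra `D(X)`. -/
def dual (X : HFor.{u}) : PHilz.{u} := ⟨DualCarrier X⟩

/-- The dual of a morphism `f : X ⟶ Y` is `U ↦ f⁻¹(U)`. -/
def dualMap {X Y : HFor.{u}} (f : X ⟶ Y) : Y.dual ⟶ X.dual :=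
  PHilz.Hom.mk (H := Y.dual) (G := X.dual)
    (fun U : DualCarrier Y =>
      (⟨Hom.toFun f ⁻¹' U.set, Hom.preimage_mem f _ U.compl_mem⟩ : DualCarrier X))
    (fun U V => by
      apply DualCarrier.ext
      ext x
      refine (DualCarrier.mem_imp U V (Hom.toFun f x)).trans
        (Iff.trans ?_ (DualCarrier.mem_imp _ _ x).symm)
      constructor
      · exact fun h y hy hU => h _ (Hom.monotone f hy) hU
      · intro h y hy hU
        obtain ⟨z, hz, rfl⟩ := Hom.isOpen f _ _ hy
        exact h z hz hU)
    rfl rfl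

/-! ### The object `X ⊗ Y` -/

/-- A `u`-succession of a poset `F`: a finite set `{f₀ < ⋯ < fₙ}` whose least element `f₀` is
minimal in `F`. -/
def IsUSuccession {F : Type u} [PartialOrder F] (p : Set F) : Prop :=
  p.Finite ∧ IsChain (· ≤ ·) p ∧ ∃ f₀ : F, IsLeast p f₀ ∧ IsMin f₀

/-- The set `S ⊗ T` of those `u`-successions `p = {p₀ < ⋯ < pₖ}` of `S × T` for which
`π₁(p) = (π₁(pₖ)]` and `π₂(p) = (π₂(pₖ)]`. -/
structure Tensor (S T : Type u) [PartialOrder S] [PartialOrder T] : Type u where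
  set : Set (S × T)
  isUSuccession : IsUSuccession set
  proj : ∃ m : S × T, IsGreatest set m ∧
    Prod.fst '' set = Set.Iic m.1 ∧ Prod.snd '' set = Set.Iic m.2

namespace Tensor

variable {S T : Type u} [PartialOrder S] [PartialOrder T]

@[ext]
theorem ext {p q : Tensor S T} (h : p.set = q.set) : p = q := by
  cases p; cases q; cases h; rfl

/-- The last element `pₖ` of `p = {p₀ < ⋯ < pₖ}`. -/
noncomputable def last (p : Tensor S T) : S × T := p.proj.choose

theorem last_isGreatest (p : Tensor S T) : IsGreatest p.set p.last := p.proj.choose_spec.1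

theorem fst_image (p : Tensor S T) : Prod.fst '' p.set = Set.Iic p.last.1 :=
  p.proj.choose_spec.2.1

theorem snd_image (p : Tensor S T) : Prod.snd '' p.set = Set.Iic p.last.2 :=
  p.proj.choose_spec.2.2

/-- `{p₀ < ⋯ < pₙ} ⪯ {q₀ < ⋯ < qₘ}` iff `n ≤ m` and `pᵢ = qᵢ` for `i ≤ n`, that is, the first
set is an initial segment of the second. -/
instance : PartialOrder (Tensor S T) where
  le p q := p.set ⊆ q.set ∧ ∀ x ∈ p.set, ∀ y ∈ q.set, y ≤ x → y ∈ p.set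
  le_refl p := ⟨subset_rfl, fun _ _ _ hy _ => hy⟩
  le_trans p q r hpq hqr := ⟨hpq.1.trans hqr.1, fun x hx y hy hyx =>
    hpq.2 x hx y (hqr.2 x (hpq.1 hx) y hy hyx) hyx⟩
  le_antisymm p q hpq hqp := ext (Set.Subset.antisymm hpq.1 hqp.1)

theorem le_def {p q : Tensor S T} :
    p ≤ q ↔ p.set ⊆ q.set ∧ ∀ x ∈ p.set, ∀ y ∈ q.set, y ≤ x → y ∈ p.set := Iff.rfl

instance [Finite S] [Finite T] : Finite (Tensor S T) :=
  Finite.of_injective Tensor.set fun _ _ h => ext h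

theorem forest (p : Tensor S T) : IsChain (· ≤ ·) (Set.Iic p) := by
  intro q hq r hr _
  change q ≤ p at hq
  change r ≤ p at hr
  by_cases h : q.set ⊆ r.set
  · exact Or.inl ⟨h, fun x hx y hy hyx => hq.2 x hx y (hr.1 hy) hyx⟩
  · obtain ⟨x, hxq, hxr⟩ := Set.not_subset.1 h
    refine Or.inr ⟨fun y hy => ?_, fun x hx y hy hyx => hr.2 x hx y (hq.1 hy) hyx⟩
    rcases p.isUSuccession.2.1.total (hq.1 hxq) (hr.1 hy) with hxy | hyx
    · exact absurd (hr.2 y hy x (hq.1 hxq) hxy) hxr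
    · exact hq.2 x hxq y (hr.1 hy) hyx

/-- `π̄₁(p) = max π₁(p)`. -/
noncomputable def fst (p : Tensor S T) : S := p.last.1

/-- `π̄₂(p) = max π₂(p)`. -/
noncomputable def snd (p : Tensor S T) : T := p.last.2

theorem fst_mono : Monotone (fst : Tensor S T → S) := fun p q h =>
  (q.last_isGreatest.2 (h.1 p.last_isGreatest.1)).1

theorem snd_mono : Monotone (snd : Tensor S T → T) := fun p q h =>
  (q.last_isGreatest.2 (h.1 p.last_isGreatest.1)).2

/-- The initial segment of `p` that ends in `x`. -/
theorem exists_restrict (p : Tensor S T) {x : S × T} (hx : x ∈ p.set) :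
    ∃ q ≤ p, q.last = x := by
  have hg : IsGreatest {y | y ∈ p.set ∧ y ≤ x} x := ⟨⟨hx, le_rfl⟩, fun y hy => hy.2⟩
  have h1 : Prod.fst '' {y | y ∈ p.set ∧ y ≤ x} = Set.Iic x.1 := by
    ext s
    constructor
    · rintro ⟨y, ⟨_, hyx⟩, rfl⟩
      exact hyx.1
    · intro hs
      have hs' : s ∈ Set.Iic p.last.1 := le_trans hs (p.last_isGreatest.2 hx).1
      rw [← p.fst_image] at hs'
      obtain ⟨y, hy, rfl⟩ := hs'
      rcases p.isUSuccession.2.1.total hy hx with h | h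
      · exact ⟨y, ⟨hy, h⟩, rfl⟩
      · exact ⟨x, ⟨hx, le_rfl⟩, le_antisymm h.1 hs⟩
  have h2 : Prod.snd '' {y | y ∈ p.set ∧ y ≤ x} = Set.Iic x.2 := by
    ext s
    constructor
    · rintro ⟨y, ⟨_, hyx⟩, rfl⟩
      exact hyx.2
    · intro hs
      have hs' : s ∈ Set.Iic p.last.2 := le_trans hs (p.last_isGreatest.2 hx).2
      rw [← p.snd_image] at hs'
      obtain ⟨y, hy, rfl⟩ := hs'
      rcases p.isUSuccession.2.1.total hy hx with h | h
      · exact ⟨y, ⟨hy, h⟩, rfl⟩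
      · exact ⟨x, ⟨hx, le_rfl⟩, le_antisymm h.2 hs⟩
  obtain ⟨hfin, hchain, f₀, hf₀, hmin⟩ := p.isUSuccession
  let q : Tensor S T := ⟨{y | y ∈ p.set ∧ y ≤ x},
    ⟨hfin.subset fun y hy => hy.1, hchain.mono fun y hy => hy.1, f₀,
      ⟨⟨hf₀.1, hf₀.2 hx⟩, fun y hy => hf₀.2 hy.1⟩, hmin⟩, x, hg, h1, h2⟩
  exact ⟨q, ⟨fun y hy => hy.1, fun a ha y hy hya => ⟨hy, hya.trans ha.2⟩⟩,
    q.last_isGreatest.unique hg⟩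

end Tensor

/-- The family `B_X ⊗ B_Y`. -/
def tensorBase (X Y : HFor.{u}) : Set (Set (Tensor X Y)) :=
  {U | (∃ p : Tensor X Y, U = Set.Ici p) ∨
    (∃ V ∈ X.base, ∃ T : Set (Tensor X Y),
      T ⊆ {p | Minimal (· ∈ Tensor.fst ⁻¹' V) p} ∧ U = upperClosure T) ∨
    (∃ V ∈ Y.base, ∃ T : Set (Tensor X Y),
      T ⊆ {p | Minimal (· ∈ Tensor.snd ⁻¹' V) p} ∧ U = upperClosure T)}

theorem upperClosure_minimal {X : Type u} [PartialOrder X] [Finite X] {U : Set X}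
    (hU : IsUpperSet U) : U = upperClosure {x | Minimal (· ∈ U) x} := by
  ext x
  simp only [SetLike.mem_coe, mem_upperClosure]
  constructor
  · intro hx
    obtain ⟨m, hm, h⟩ := exists_minimal_le hx
    exact ⟨m, h, hm⟩
  · rintro ⟨m, hm, hmx⟩
    exact hU hmx hm.1

theorem fst_preimage_mem (X Y : HFor.{u}) {V : Set X} (hV : V ∈ X.base) :
    (Tensor.fst ⁻¹' V : Set (Tensor X Y)) ∈ tensorBase X Y :=
  Or.inr (Or.inl ⟨V, hV, _, subset_rfl,
    upperClosure_minimal ((X.isHBase.upper V hV).preimage Tensor.fst_mono)⟩)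

theorem snd_preimage_mem (X Y : HFor.{u}) {V : Set Y} (hV : V ∈ Y.base) :
    (Tensor.snd ⁻¹' V : Set (Tensor X Y)) ∈ tensorBase X Y :=
  Or.inr (Or.inr ⟨V, hV, _, subset_rfl,
    upperClosure_minimal ((Y.isHBase.upper V hV).preimage Tensor.snd_mono)⟩)

theorem minimal_upperClosure {X : Type u} [PartialOrder X] {T : Set X} {x : X}
    (hx : Minimal (· ∈ (upperClosure T : Set X)) x) : x ∈ T := by
  obtain ⟨y, hy, hyx⟩ := mem_upperClosure.1 hx.1
  have : x ≤ y := hx.2 (subset_upperClosure hy) hyx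
  rwa [le_antisymm this hyx]

theorem tensorBase_isHBase (X Y : HFor.{u}) : IsHBase (tensorBase X Y) where
  upper := by
    rintro U (⟨p, rfl⟩ | ⟨V, _, T, _, rfl⟩ | ⟨V, _, T, _, rfl⟩)
    · exact isUpperSet_Ici p
    · exact (upperClosure T).upper
    · exact (upperClosure T).upper
  cone_mem p := Or.inl ⟨p, rfl⟩
  minimal_mem := by
    rintro U (⟨p, rfl⟩ | ⟨V, hV, T, hT, rfl⟩ | ⟨V, hV, T, hT, rfl⟩) M hM
    · have hMp : M ⊆ {p} := fun x hx => by
        have := hM hx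
        exact le_antisymm (this.2 (Set.mem_Ici.2 le_rfl) this.1) this.1
      rcases Set.subset_singleton_iff_eq.1 hMp with rfl | rfl
      · exact Or.inr (Or.inl ⟨_, X.univ_mem, ∅, Set.empty_subset _, rfl⟩)
      · exact Or.inl ⟨p, by simp⟩
    · exact Or.inr (Or.inl ⟨V, hV, M, fun x hx => hT (minimal_upperClosure (hM hx)), rfl⟩)
    · exact Or.inr (Or.inr ⟨V, hV, M, fun x hx => hT (minimal_upperClosure (hM hx)), rfl⟩)

/-- The object `(X ⊗ Y, ⪯, B_X ⊗ B_Y)`. -/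
def tensor (X Y : HFor.{u}) : HFor.{u} where
  carrier := Tensor X Y
  forest := Tensor.forest
  base := tensorBase X Y
  isHBase := tensorBase_isHBase X Y
  univ_mem := by simpa using fst_preimage_mem X Y X.univ_mem

/-- The projection `π̄₁ : X ⊗ Y ⟶ X`. -/
noncomputable def tensorFst (X Y : HFor.{u}) : tensor X Y ⟶ X :=
  Hom.mk (X := tensor X Y) (Y := X) (Tensor.fst : Tensor X Y → X) Tensor.fst_mono
    (fun (p : Tensor X Y) s hs => by
      have hs' : s ∈ Set.Iic p.last.1 := hs
      rw [← p.fst_image] at hs'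
      obtain ⟨y, hy, rfl⟩ := hs'
      obtain ⟨q, hq, rfl⟩ := p.exists_restrict hy
      exact ⟨q, hq, rfl⟩)
    (fun _ hV => fst_preimage_mem X Y hV)

/-- The projection `π̄₂ : X ⊗ Y ⟶ Y`. -/
noncomputable def tensorSnd (X Y : HFor.{u}) : tensor X Y ⟶ Y :=
  Hom.mk (X := tensor X Y) (Y := Y) (Tensor.snd : Tensor X Y → Y) Tensor.snd_mono
    (fun (p : Tensor X Y) s hs => by
      have hs' : s ∈ Set.Iic p.last.2 := hs
      rw [← p.snd_image] at hs'
      obtain ⟨y, hy, rfl⟩ := hs'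
      obtain ⟨q, hq, rfl⟩ := p.exists_restrict hy
      exact ⟨q, hq, rfl⟩)
    (fun _ hV => snd_preimage_mem X Y hV)

end HFor

/-! ### The dual forest of a finite bounded prelinear Hilbert algebra -/

namespace PHilz

/-- Irreducible implicative filters of `H`. -/
structure Point (H : PHilz.{u}) : Type u where
  set : Set H
  irreducible : IsIrreducibleFilter set

@[ext]
theorem Point.ext {H : PHilz.{u}} {P Q : Point H} (h : P.set = Q.set) : P = Q := by
  cases P; cases Q; cases h; rfl

/-- Irreducible filters are ordered by reverse inclusion, which turns the root system of
irreducible filters into a forest. -/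
instance (H : PHilz.{u}) : PartialOrder (Point H) where
  le P Q := Q.set ⊆ P.set
  le_refl _ := subset_rfl
  le_trans _ _ _ h₁ h₂ := Set.Subset.trans h₂ h₁
  le_antisymm _ _ h₁ h₂ := Point.ext (Set.Subset.antisymm h₂ h₁)

instance (H : PHilz.{u}) [Finite H] : Finite (Point H) :=
  Finite.of_injective Point.set fun _ _ h => Point.ext h

/-- `φ(a) = {P : a ∈ P}`. -/
def phi {H : PHilz.{u}} (a : H) : Set (Point H) := {P | a ∈ P.set}

theorem point_forest {H : PHilz.{u}} (P : Point H) : IsChain (· ≤ ·) (Set.Iic P) := by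
  intro Q hQ Z hZ _
  change P.set ⊆ Q.set at hQ
  change P.set ⊆ Z.set at hZ
  change Z.set ⊆ Q.set ∨ Q.set ⊆ Z.set
  by_contra hcon
  push Not at hcon
  obtain ⟨b, hbZ, hbQ⟩ := Set.not_subset.1 hcon.1
  obtain ⟨a, haQ, haZ⟩ := Set.not_subset.1 hcon.2
  have hab : a ⇨ b ∉ P.set := fun h => hbQ (Q.irreducible.1.2 _ _ haQ (hQ h))
  have hba : b ⇨ a ∉ P.set := fun h => haZ (Z.irreducible.1.2 _ _ hbZ (hZ h))
  obtain ⟨f1, f2, f3⟩ := P.irreducible.1.extend (a ⇨ b)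
  obtain ⟨g1, g2, g3⟩ := P.irreducible.1.extend (b ⇨ a)
  have heq : P.set = {x | (a ⇨ b) ⇨ x ∈ P.set} ∩ {x | (b ⇨ a) ⇨ x ∈ P.set} := by
    refine Set.Subset.antisymm (fun x hx => ⟨f2 hx, g2 hx⟩) fun x hx => ?_
    refine P.irreducible.1.2 _ _ hx.2 (P.irreducible.1.2 _ _ hx.1 ?_)
    rw [BoundedPrelinearHilbertAlgebra.prelinear]
    exact P.irreducible.1.1
  rcases P.irreducible.2.2 _ _ f1 g1 heq with h | h
  · exact hab (by rw [h]; exact f3)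
  · exact hba (by rw [h]; exact g3)

theorem bot_notMem {H : PHilz.{u}} (P : Point H) : (⊥ : H) ∉ P.set := fun h =>
  P.irreducible.2.1 (Set.eq_univ_of_forall fun a => P.irreducible.1.2 _ a h (by
    rw [BoundedPrelinearHilbertAlgebra.bot_imp]; exact P.irreducible.1.1))

theorem phi_isHBase (H : PHilz.{u}) [Finite H] :
    IsHBase {U : Set (Point H) | ∃ a : H, U = (phi a)ᶜ} where
  upper := by
    rintro _ ⟨a, rfl⟩ P Q hPQ hP hQ
    exact hP (hPQ hQ)
  cone_mem P := by
    obtain ⟨a, ha⟩ := exists_cone P.irreducible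
    refine ⟨a, ?_⟩
    ext Q
    exact (ha Q.set Q.irreducible.1).symm
  minimal_mem := by
    rintro _ ⟨a, rfl⟩ M hM
    choose c hc using fun P : Point H => exists_cone P.irreducible
    obtain ⟨b, hb⟩ := exists_imp_set a
      (c '' {P | Minimal (· ∈ (phi a)ᶜ) P ∧ P ∉ M})
    refine ⟨b, ?_⟩
    ext Q
    rw [SetLike.mem_coe, mem_upperClosure]
    refine Iff.trans ?_ (hb Q.set Q.irreducible.1).symm
    constructor
    · rintro ⟨P, hP, hPQ⟩
      refine ⟨P.set, P.irreducible, hPQ, ?_, (hM hP).1⟩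
      rintro _ ⟨R, ⟨hR, hRM⟩, rfl⟩
      by_contra hcR
      have hRP : R ≤ P := (hc R P.set P.irreducible.1).1 hcR
      have : P ≤ R := (hM hP).2 hR.1 hRP
      exact hRM (le_antisymm hRP this ▸ hP)
    · rintro ⟨R, hR, hQR, hs, haR⟩
      obtain ⟨m, hm, hmin⟩ := HFor.exists_minimal_le (U := (phi a)ᶜ) (x := (⟨R, hR⟩ : Point H)) haR
      refine ⟨m, ?_, hm.trans hQR⟩
      by_contra hmM
      exact (hc m R hR.1).2 hm (hs ⟨m, ⟨hmin, hmM⟩, rfl⟩)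

/-- The dual object of a finite bounded prelinear Hilbert algebra `H`: the forest of irreducible
implicative filters with the family of sets `φ(a)ᶜ`, `a ∈ H`. -/
def spec (H : PHilz.{u}) [Finite H] : HFor.{u} where
  carrier := Point H
  forest := point_forest
  base := {U : Set (Point H) | ∃ a : H, U = (phi a)ᶜ}
  isHBase := phi_isHBase H
  univ_mem := ⟨⊥, by
    ext P
    simpa [phi] using bot_notMem P⟩

/-- The canonical map `φ : H ⟶ D(X(H))`, `a ↦ φ(a)`. -/
def unit (H : PHilz.{u}) [Finite H] : H ⟶ (spec H).dual :=
  PHilz.Hom.mk (H := H) (G := (spec H).dual)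
    (fun a => (⟨phi a, a, rfl⟩ : HFor.DualCarrier (spec H)))
    (fun a b => by
      apply HFor.DualCarrier.ext
      ext P
      refine Iff.trans ?_ (HFor.DualCarrier.mem_imp (X := spec H) _ _ P).symm
      refine (imp_mem_iff (Point.irreducible P).1 a b).trans ?_
      exact ⟨fun h Q hQ => h Q.set Q.irreducible hQ, fun h Q hQ hPQ => h ⟨Q, hQ⟩ hPQ⟩)
    (by
      apply HFor.DualCarrier.ext
      exact Set.eq_univ_of_forall fun P => (Point.irreducible P).1.1)
    (by
      apply HFor.DualCarrier.ext
      exact Set.eq_empty_of_forall_notMem fun P => bot_notMem P)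

/-- The algebra `D(X(H) ⊗ X(G))`. -/
def tensorDual (H G : PHilz.{u}) [Finite H] [Finite G] : PHilz.{u} :=
  (HFor.tensor (spec H) (spec G)).dual

/-- The map `H ⟶ D(X(H) ⊗ X(G))` induced by the first projection. -/
noncomputable def inl (H G : PHilz.{u}) [Finite H] [Finite G] : H ⟶ tensorDual H G :=
  unit H ≫ HFor.dualMap (HFor.tensorFst (spec H) (spec G))

/-- The map `G ⟶ D(X(H) ⊗ X(G))` induced by the second projection. -/
noncomputable def inr (H G : PHilz.{u}) [Finite H] [Finite G] : G ⟶ tensorDual H G :=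
  unit G ≫ HFor.dualMap (HFor.tensorSnd (spec H) (spec G))

end PHilz

/-!
Order the irreducible filters of a prelinear algebra `K` by reverse inclusion. Even for infinite `K`
they form a forest that separates the elements of `K`, and `a ⇨ b ∈ P` says that every `Q ≤ P`
containing `a` contains `b`. Thus, as in a Kripke model, membership of a compound element in `P`
depends only on what happens on `(P]`.

For a finite set `S`, membership in `P` of an element of the subalgebra generated by `S` is therefore
determined by the finite chain of traces `{Q ∩ S : Q ≤ P}` (`Generated.mem_iff_of_trace_eq`). There
are finitely many such chains, and `K` is locally finite.

For homomorphisms `f : H ⟶ K` and `g : G ⟶ K` with `H` and `G` finite, the inverse images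
`{(f⁻¹(Q), g⁻¹(Q)) : Q ≤ P}` form an element `pairing f g P` of `X(H) ⊗ X(G)`, because inverse
image along a homomorphism is an open map that preserves minimal elements (`Point.exists_comap_eq`,
`Point.isMin_comap`). The map `pairing f g` is itself monotone and open. Hence the elements `d` of
`D(X(H) ⊗ X(G))` for which some `k` in `K` satisfies `pairing f g P ∈ d ↔ k ∈ P` for all `P` are
closed under implication; they include the images of `H` and `G`, and `d ↦ k` is the required
homomorphism as soon as these images generate. Generation also gives uniqueness.

Generation (`generated_inl_inr`) is a statement about forests. An implication `U ⇒ W` deletes from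
the minimal elements of `Wᶜ` those outside `U`, so it suffices to obtain the complements of cones,
and for these to separate elements of `X ⊗ Y`. Two elements that branch off at the same place either
differ in a coordinate that one of them has reached and the other has not, or reach the same pair of
coordinates in a different order, which implications between inverse images of cones detect
(`JointlyFaithful.mem_imp_and_notMem_imp`).
-/

/-! ### Irreducible filters of an arbitrary algebra -/

section Filters

variable {α : Type u} [HilbertAlgebra α]

theorem IsImplicativeFilter.singleton_top : IsImplicativeFilter ({⊤} : Set α) :=
  ⟨rfl, fun _ _ ha hab => HilbertAlgebra.mp ha hab⟩

theorem IsImplicativeFilter.exists_maximal_disjoint {F C : Set α} (hF : IsImplicativeFilter F)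
    (hC : Disjoint F C) :
    ∃ P, F ⊆ P ∧ Maximal (fun G => IsImplicativeFilter G ∧ Disjoint G C) P := by
  refine zorn_subset_nonempty {G | IsImplicativeFilter G ∧ Disjoint G C} ?_ F ⟨hF, hC⟩
  refine fun c hc hchain hne => ⟨⋃₀ c, ⟨⟨?_, ?_⟩, ?_⟩, fun s hs => Set.subset_sUnion_of_mem hs⟩
  · obtain ⟨s, hs⟩ := hne
    exact ⟨s, hs, (hc hs).1.1⟩
  · rintro a b ⟨s, hs, ha⟩ ⟨t, ht, hab⟩
    rcases hchain.total hs ht with h | h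
    · exact ⟨t, ht, (hc ht).1.2 a b (h ha) hab⟩
    · exact ⟨s, hs, (hc hs).1.2 a b ha (h hab)⟩
  · exact Set.disjoint_sUnion_left.2 fun s hs => (hc hs).2

/-- The version of `exists_irreducible` for algebras that need not be finite. -/
theorem IsImplicativeFilter.exists_irreducible_notMem {F : Set α} (hF : IsImplicativeFilter F)
    {b : α} (hb : b ∉ F) : ∃ P, IsIrreducibleFilter P ∧ F ⊆ P ∧ b ∉ P := by
  obtain ⟨P, hFP, hP⟩ := hF.exists_maximal_disjoint (Set.disjoint_singleton_right.2 hb)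
  have hbP : b ∉ P := Set.disjoint_singleton_right.1 hP.prop.2
  refine ⟨P, ⟨hP.prop.1, fun h => hbP (h ▸ Set.mem_univ b), fun F₁ F₂ h₁ h₂ h => ?_⟩, hFP, hbP⟩
  have key : ∀ G, IsImplicativeFilter G → P ⊆ G → b ∉ G → P = G := fun G hG hPG hbG =>
    hPG.antisymm (hP.2 ⟨hG, Set.disjoint_singleton_right.2 hbG⟩ hPG)
  by_cases hb₁ : b ∈ F₁
  · exact Or.inr (key F₂ h₂ (h ▸ Set.inter_subset_right) fun hb₂ => hbP (h ▸ ⟨hb₁, hb₂⟩))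
  · exact Or.inl (key F₁ h₁ (h ▸ Set.inter_subset_left) hb₁)

theorem isIrreducibleFilter_of_total {F : Set α} (hF : IsImplicativeFilter F)
    (hne : F ≠ Set.univ) (htot : ∀ a b, a ⇨ b ∈ F ∨ b ⇨ a ∈ F) : IsIrreducibleFilter F := by
  refine ⟨hF, hne, fun F₁ F₂ h₁ h₂ h => ?_⟩
  have hs₁ : F ⊆ F₁ := h ▸ Set.inter_subset_left
  have hs₂ : F ⊆ F₂ := h ▸ Set.inter_subset_right
  by_contra! hcon
  obtain ⟨a, ha, haF⟩ := Set.exists_of_ssubset (hs₁.ssubset_of_ne hcon.1)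
  obtain ⟨b, hb, hbF⟩ := Set.exists_of_ssubset (hs₂.ssubset_of_ne hcon.2)
  rcases htot a b with hab | hab
  · exact hbF (h ▸ ⟨h₁.2 a b ha (hs₁ hab), hb⟩)
  · exact haF (h ▸ ⟨ha, h₂.2 b a hb (hs₂ hab)⟩)

end Filters

namespace PHilz.Point

variable {H K : PHilz.{u}}

theorem imp_mem_iff (P : Point K) (a b : K) :
    a ⇨ b ∈ P.set ↔ ∀ Q ≤ P, a ∈ Q.set → b ∈ Q.set := by
  refine ⟨fun h Q hQ ha => Q.irreducible.1.2 _ _ ha (hQ h), fun h => ?_⟩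
  by_contra hab
  obtain ⟨h1, h2, h3⟩ := P.irreducible.1.extend a
  obtain ⟨Q, hQ, hs, hb⟩ := h1.exists_irreducible_notMem (b := b) hab
  exact hb (h ⟨Q, hQ⟩ (h2.trans hs) (hs h3))

theorem eq_of_forall_mem_iff {a b : K} (h : ∀ P : Point K, a ∈ P.set ↔ b ∈ P.set) : a = b := by
  have key : ∀ {c d : K}, (∀ P : Point K, c ∈ P.set → d ∈ P.set) → c ⇨ d = ⊤ := by
    intro c d hcd
    by_contra hne
    obtain ⟨P, hP, -, hb⟩ :=
      IsImplicativeFilter.singleton_top.exists_irreducible_notMem (b := c ⇨ d) hne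
    exact hb ((imp_mem_iff ⟨P, hP⟩ c d).2 fun Q _ => hcd Q)
  exact HilbertAlgebra.imp_antisymm a b (key fun P => (h P).1) (key fun P => (h P).2)

/-- This is where prelinearity enters: modulo an irreducible filter the algebra is a chain. -/
theorem imp_mem_or_imp_mem (P : Point K) (a b : K) : a ⇨ b ∈ P.set ∨ b ⇨ a ∈ P.set := by
  obtain ⟨f1, f2, f3⟩ := P.irreducible.1.extend (a ⇨ b)
  obtain ⟨g1, g2, g3⟩ := P.irreducible.1.extend (b ⇨ a)
  refine (P.irreducible.2.2 _ _ f1 g1 (Set.Subset.antisymm (fun x hx => ⟨f2 hx, g2 hx⟩) ?_)).imp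
    (fun h => by rw [h]; exact f3) (fun h => by rw [h]; exact g3)
  refine fun x hx => P.irreducible.1.2 _ _ hx.2 (P.irreducible.1.2 _ _ hx.1 ?_)
  rw [BoundedPrelinearHilbertAlgebra.prelinear]
  exact P.irreducible.1.1

theorem isMin_iff (P : Point K) : IsMin P ↔ ∀ a ∉ P.set, a ⇨ ⊥ ∈ P.set := by
  constructor
  · intro hP a ha
    exact (imp_mem_iff P a ⊥).2 fun Q hQ haQ => absurd (hP hQ haQ) ha
  · intro h Q hQ a ha
    by_contra haP
    exact bot_notMem Q (Q.irreducible.1.2 _ _ ha (hQ (h a haP)))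

theorem exists_isMin_le (P : Point K) : ∃ Q ≤ P, IsMin Q := by
  obtain ⟨Q, hPQ, hQ⟩ := P.irreducible.1.exists_maximal_disjoint
    (Set.disjoint_singleton_right.2 (bot_notMem P))
  have hbot := Set.disjoint_singleton_right.1 hQ.prop.2
  refine ⟨⟨Q, isIrreducibleFilter_of_total hQ.prop.1 (fun h => hbot (h ▸ Set.mem_univ _))
    fun a b => (imp_mem_or_imp_mem P a b).imp (hPQ ·) (hPQ ·)⟩, hPQ, fun R hR => ?_⟩
  exact hQ.2 ⟨R.irreducible.1, Set.disjoint_singleton_right.2 (bot_notMem R)⟩ hR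

/-- The inverse image of an irreducible filter under a homomorphism. -/
def comap (f : H ⟶ K) (P : Point K) : Point H where
  set := {a | Hom.toFun f a ∈ P.set}
  irreducible := by
    refine isIrreducibleFilter_of_total ⟨?_, fun a b ha hab => ?_⟩ ?_ fun a b => ?_
    · change Hom.toFun f ⊤ ∈ P.set
      rw [Hom.map_top]; exact P.irreducible.1.1
    · change Hom.toFun f (a ⇨ b) ∈ P.set at hab
      rw [Hom.map_imp] at hab
      exact P.irreducible.1.2 _ _ ha hab
    · intro h
      have : Hom.toFun f ⊥ ∈ P.set := Set.eq_univ_iff_forall.1 h ⊥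
      rw [Hom.map_bot] at this
      exact bot_notMem P this
    · change Hom.toFun f (a ⇨ b) ∈ P.set ∨ Hom.toFun f (b ⇨ a) ∈ P.set
      rw [Hom.map_imp, Hom.map_imp]
      exact imp_mem_or_imp_mem P _ _

theorem mem_comap (f : H ⟶ K) (P : Point K) (a : H) :
    a ∈ (comap f P).set ↔ Hom.toFun f a ∈ P.set := Iff.rfl

theorem comap_mono (f : H ⟶ K) : Monotone (comap f) := fun _ _ h _ ha => h ha

theorem isMin_comap (f : H ⟶ K) {P : Point K} (hP : IsMin P) : IsMin (comap f P) := by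
  rw [isMin_iff] at hP ⊢
  intro a ha
  rw [mem_comap, Hom.map_imp, Hom.map_bot]
  exact hP _ ha

/-- Inverse image along a homomorphism is an open map of forests: a filter `Q ⊇ P` that is maximal
subject to `f⁻¹(Q) ⊆ R` has inverse image `R`. -/
theorem exists_comap_eq (f : H ⟶ K) (P : Point K) {R : Point H} (hR : R ≤ comap f P) :
    ∃ Q ≤ P, comap f Q = R := by
  have hdisj : ∀ G : Set K,
      Disjoint G (Hom.toFun f '' R.setᶜ) ↔ ∀ a, Hom.toFun f a ∈ G → a ∈ R.set := fun G => by
    rw [Set.disjoint_right, Set.forall_mem_image]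
    exact forall_congr' fun a => not_imp_not
  obtain ⟨Q, hPQ, hQ⟩ := P.irreducible.1.exists_maximal_disjoint ((hdisj _).2 hR)
  have hQR := (hdisj Q).1 hQ.prop.2
  have hbot : (⊥ : K) ∉ Q := fun h =>
    bot_notMem R (hQR ⊥ (by rw [Hom.map_bot]; exact h))
  refine ⟨⟨Q, isIrreducibleFilter_of_total hQ.prop.1 (fun h => hbot (h ▸ Set.mem_univ _))
    fun a b => (imp_mem_or_imp_mem P a b).imp (hPQ ·) (hPQ ·)⟩, hPQ, ?_⟩
  apply Point.ext
  refine Set.Subset.antisymm hQR fun r hr => ?_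
  -- Adjoining the image of `r` to `Q` creates no new elements of the inverse image outside `R`.
  obtain ⟨h1, h2, h3⟩ := hQ.prop.1.extend (Hom.toFun f r)
  refine hQ.2 ⟨h1, (hdisj _).2 fun a ha => ?_⟩ h2 h3
  change Hom.toFun f r ⇨ Hom.toFun f a ∈ Q at ha
  rw [← Hom.map_imp] at ha
  exact R.irreducible.1.2 _ _ hr (hQR _ ha)

end PHilz.Point

/-! ### Local finiteness -/

/-- A monotone map on a forest carries the part of `(x]` below `y ≤ x` to the part of the image
of `(x]` below the image of `y`. -/
theorem image_Iic_inter_Iic {F E : Type*} [PartialOrder F] [PartialOrder E] {φ : F → E}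
    (hφ : Monotone φ) {x y : F} (hx : IsChain (· ≤ ·) (Set.Iic x)) (hy : y ≤ x) :
    φ '' Set.Iic x ∩ Set.Iic (φ y) = φ '' Set.Iic y := by
  ext e
  constructor
  · rintro ⟨⟨z, hz, rfl⟩, hzy⟩
    rcases hx.total hz hy with h | h
    · exact ⟨z, h, rfl⟩
    · exact ⟨y, le_rfl, (hφ h).antisymm hzy⟩
  · rintro ⟨z, hz, rfl⟩
    exact ⟨⟨z, le_trans hz hy, rfl⟩, hφ hz⟩

namespace PHilz

variable {K : PHilz.{u}}

/-- The trace on `S` of an irreducible filter, ordered by reverse inclusion. -/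
def trace (S : Set K) (P : Point K) : (Set K)ᵒᵈ := OrderDual.toDual (P.set ∩ S)

theorem trace_mono (S : Set K) : Monotone (trace S) := fun _ _ h _ hx => ⟨h hx.1, hx.2⟩

/-- Whether a member of the subalgebra generated by `S` belongs to `P` depends only on the traces
on `S` of the irreducible filters that contain `P`. -/
theorem Generated.mem_iff_of_trace_eq {S : Set K} {x : K} (hx : Generated S x) :
    ∀ {P Q : Point K}, trace S '' Set.Iic P = trace S '' Set.Iic Q →
      (x ∈ P.set ↔ x ∈ Q.set) := by
  suffices ∀ {P Q : Point K}, trace S '' Set.Iic P = trace S '' Set.Iic Q →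
      x ∈ P.set → x ∈ Q.set from fun {_ _} h => ⟨this h, this h.symm⟩
  have down : ∀ {P Q : Point K}, trace S '' Set.Iic P = trace S '' Set.Iic Q →
      ∀ Q' ≤ Q, ∃ P' ≤ P, trace S '' Set.Iic P' = trace S '' Set.Iic Q' := by
    intro P Q h Q' hQ'
    obtain ⟨P', hP', he⟩ : trace S Q' ∈ trace S '' Set.Iic P := h ▸ ⟨Q', hQ', rfl⟩
    refine ⟨P', hP', ?_⟩
    rw [← image_Iic_inter_Iic (trace_mono S) (point_forest P) hP',
      ← image_Iic_inter_Iic (trace_mono S) (point_forest Q) hQ', h, he]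
  induction hx with
  | of a ha =>
    intro P Q h haP
    obtain ⟨P', hP', he⟩ : trace S Q ∈ trace S '' Set.Iic P := h ▸ ⟨Q, le_refl Q, rfl⟩
    have : P'.set ∩ S = Q.set ∩ S := he
    exact (this ▸ ⟨hP' haP, ha⟩ : a ∈ Q.set ∩ S).1
  | top => exact fun {P Q} _ _ => Q.irreducible.1.1
  | bot => exact fun {P Q} _ h => absurd h (bot_notMem P)
  | imp a b _ _ iha ihb =>
    intro P Q h hab
    rw [Point.imp_mem_iff] at hab ⊢
    intro Q' hQ' ha
    obtain ⟨P', hP', he⟩ := down h Q' hQ'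
    exact ihb he (hab P' hP' (iha he.symm ha))

/-- The traces on `S` form a finite set, and members of the generated subalgebra are told apart by
the sets of traces belonging to the irreducible filters that contain them. -/
theorem finite_generated {S : Set K} (hS : S.Finite) : {x : K | Generated S x}.Finite := by
  let Φ : K → Set (Set (Set K)ᵒᵈ) := fun x => (fun P => trace S '' Set.Iic P) '' phi x
  have hfin : {A : Set (Set (Set K)ᵒᵈ) | A ⊆ {B | B ⊆ {s | OrderDual.ofDual s ⊆ S}}}.Finite :=
    (Set.Finite.finite_subsets (Set.Finite.finite_subsets hS.finite_subsets))
  refine Set.Finite.of_finite_image (f := Φ) (hfin.subset ?_) fun x hx y hy hxy => ?_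
  · rintro _ ⟨x, -, rfl⟩ _ ⟨P, -, rfl⟩ _ ⟨Q, -, rfl⟩
    exact Set.inter_subset_right
  · have key : ∀ {a b : K}, Generated S b → Φ a = Φ b → ∀ P : Point K, a ∈ P.set → b ∈ P.set := by
      intro a b hb hab P ha
      obtain ⟨Q, hQ, he⟩ : trace S '' Set.Iic P ∈ Φ b := hab ▸ ⟨P, ha, rfl⟩
      exact (hb.mem_iff_of_trace_eq he).1 hQ
    exact Point.eq_of_forall_mem_iff fun P => ⟨key hy hxy P, key hx hxy.symm P⟩

end PHilz

/-! ### Elements of the tensor product -/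

namespace HFor

namespace Tensor

variable {S T : Type u} [PartialOrder S] [PartialOrder T]

theorem mem_of_le_of_le_last {p q : Tensor S T} (hqp : q ≤ p) {y : S × T} (hy : y ∈ p.set)
    (hyq : y ≤ q.last) : y ∈ q.set :=
  hqp.2 _ q.last_isGreatest.1 y hy hyq

theorem eq_of_le_of_last_le {p q : Tensor S T} (hqp : q ≤ p) (h : p.last ≤ q.last) : q = p :=
  ext (hqp.1.antisymm fun _ hy =>
    mem_of_le_of_le_last hqp hy ((p.last_isGreatest.2 hy).trans h))

theorem eq_of_le_of_fst_le_of_snd_le {p q : Tensor S T} (hqp : q ≤ p) (h₁ : p.fst ≤ q.fst)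
    (h₂ : p.snd ≤ q.snd) : q = p :=
  eq_of_le_of_last_le hqp ⟨h₁, h₂⟩

theorem eq_of_Iio_eq_of_last_eq {p q : Tensor S T} (h : Set.Iio p = Set.Iio q)
    (hl : p.last = q.last) : p = q := by
  have key : ∀ {p q : Tensor S T}, Set.Iio p = Set.Iio q → p.last = q.last → p.set ⊆ q.set := by
    intro p q h hl x hx
    by_cases hxp : x = p.last
    · rw [hxp, hl]; exact q.last_isGreatest.1
    · obtain ⟨r, hr, rfl⟩ := p.exists_restrict hx
      have hrq : r ∈ Set.Iio q := h ▸ (lt_of_le_of_ne hr fun he => hxp (by rw [he]))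
      exact (Set.mem_Iio.1 hrq).le.1 r.last_isGreatest.1
  exact ext ((key h hl).antisymm (key h.symm hl.symm))

end Tensor

/-! ### The dual of the tensor product is generated by its factors -/

instance (Z : HFor.{u}) : Finite (DualCarrier Z) :=
  Finite.of_injective DualCarrier.set fun _ _ h => DualCarrier.ext h

/-- A set closed under implication that contains `W` also contains `[M)ᶜ`, for a set `M` of
minimal elements of `Wᶜ`, provided that it separates `M` from the other minimal elements. -/
theorem exists_compl_eq_upperClosure {Z : HFor.{u}} {A : Set (DualCarrier Z)}
    (hA : ∀ U ∈ A, ∀ V ∈ A, U.imp V ∈ A) {W : DualCarrier Z} (hW : W ∈ A) {M : Set Z}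
    (hM : M ⊆ {x | Minimal (· ∈ W.setᶜ) x})
    (hsep : ∀ m, Minimal (· ∈ W.setᶜ) m → m ∉ M → ∃ U ∈ A, M ⊆ U.set ∧ m ∉ U.set) :
    ∃ V ∈ A, V.setᶜ = upperClosure M := by
  -- A largest member `V` of the set with `M ⊆ (Vᶜ)ᵐ ⊆ (Wᶜ)ᵐ` must be `[M)ᶜ`: if `(Vᶜ)ᵐ` had an
  -- element outside `M`, implication by a separating `U` would remove it.
  obtain ⟨V, ⟨hVA, hMV, hVW⟩, hmax⟩ := (Set.toFinite {V : DualCarrier Z | V ∈ A ∧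
    M ⊆ {x | Minimal (· ∈ V.setᶜ) x} ∧
      ∀ x, Minimal (· ∈ V.setᶜ) x → Minimal (· ∈ W.setᶜ) x}).exists_maximalFor
    DualCarrier.set _ ⟨W, hW, hM, fun _ => id⟩
  refine ⟨V, hVA, ?_⟩
  have hsub : {x | Minimal (· ∈ V.setᶜ) x} ⊆ M := by
    intro m hm
    by_contra hmM
    obtain ⟨U, hUA, hMU, hmU⟩ := hsep m (hVW m hm) hmM
    have hle : V.set ⊆ (U.imp V).set := fun x hx =>
      (DualCarrier.mem_imp U V x).2 fun y hy _ => V.lower hx hy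
    have hiff : ∀ x, Minimal (· ∈ V.setᶜ) x → (x ∈ (U.imp V).setᶜ ↔ x ∈ U.set) := by
      intro x hx
      rw [Set.mem_compl_iff, DualCarrier.mem_imp]
      constructor
      · intro h
        by_contra hxU
        refine h fun y hy hyU => ?_
        by_contra hyV
        exact hxU (U.lower hyU (hx.2 hyV hy))
      · exact fun hxU h => hx.1 (h x le_rfl hxU)
    refine hiff m hm |>.not.2 hmU (fun hm' => hm.1 (hmax ⟨hA U hUA V hVA, ?_, ?_⟩ hle hm'))
    · exact fun x hx => ⟨(hiff x (hMV hx)).2 (hMU hx), fun y hy hyx =>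
        (hMV hx).2 (fun h => hy (hle h)) hyx⟩
    · intro x hx
      obtain ⟨y, hyx, hy⟩ := exists_minimal_le (U := V.setᶜ) (fun h => hx.1 (hle h))
      have hxU : y ∈ U.set := by
        have h : x ∉ (U.imp V).set := hx.1
        rw [DualCarrier.mem_imp] at h
        push Not at h
        obtain ⟨z, hz, hzU, hzV⟩ := h
        have hzx : x ≤ z := hx.2 (fun h => hzV ((DualCarrier.mem_imp U V z).1 h z le_rfl hzU)) hz
        exact U.lower hzU (hyx.trans hzx)
      have : x ≤ y := hx.2 ((hiff y hy).2 hxU) hyx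
      exact le_antisymm hyx this ▸ hVW y hy
  rw [← Set.Subset.antisymm hsub hMV]
  exact upperClosure_minimal (Z.isHBase.upper _ V.compl_mem)

/-- A pair of monotone open maps on a forest such that each element is determined by its proper
initial segment and its two images, and the pair of images grows strictly: the properties of the two
projections of a tensor product on which the description of its dual algebra rests. -/
structure JointlyFaithful {F S T : Type u} [PartialOrder F] [PartialOrder S] [PartialOrder T]
    (α : F → S) (β : F → T) : Prop where
  fst_mono : Monotone α
  snd_mono : Monotone β
  fst_open : ∀ p, ∀ s ≤ α p, ∃ q ≤ p, α q = s
  snd_open : ∀ p, ∀ t ≤ β p, ∃ q ≤ p, β q = t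
  strict : ∀ p, ∀ q ≤ p, α p ≤ α q → β p ≤ β q → q = p
  ext : ∀ p q, Set.Iio p = Set.Iio q → α p = α q → β p = β q → p = q

namespace JointlyFaithful

variable {Z X Y : HFor.{u}} {α : Z → X} {β : Z → Y}

theorem swap (h : JointlyFaithful α β) : JointlyFaithful β α where
  fst_mono := h.snd_mono
  snd_mono := h.fst_mono
  fst_open := h.snd_open
  snd_open := h.fst_open
  strict p q hqp h₁ h₂ := h.strict p q hqp h₂ h₁
  ext p q hpq h₁ h₂ := h.ext p q hpq h₂ h₁

/-- Below `m` the two images of `m` are not both reached, even at different elements: the larger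
of the two would have the same images as `m`. -/
theorem not_lt_of_lt (h : JointlyFaithful α β) {m q r : Z} (hq : q < m) (hα : α m ≤ α q)
    (hβ : β m ≤ β r) : ¬ r < m := by
  intro hr
  rcases (Z.forest m).total hq.le hr.le with hqr | hrq
  · exact hr.ne (h.strict m r hr.le (hα.trans (h.fst_mono hqr)) hβ)
  · exact hq.ne (h.strict m q hq.le hα (hβ.trans (h.snd_mono hrq)))

theorem minimal_or_minimal (h : JointlyFaithful α β) (p : Z) :
    Minimal (· ∈ α ⁻¹' Set.Ici (α p)) p ∨ Minimal (· ∈ β ⁻¹' Set.Ici (β p)) p := by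
  by_contra! hcon
  have key : ∀ {V : HFor.{u}} {γ : Z → V}, ¬ Minimal (· ∈ γ ⁻¹' Set.Ici (γ p)) p →
      ∃ q < p, γ p ≤ γ q := by
    intro V γ hγ
    exact (not_minimal_iff_exists_lt (P := (· ∈ γ ⁻¹' Set.Ici (γ p))) (Set.mem_Ici.2 le_rfl)).1 hγ
  obtain ⟨q, hq, hαq⟩ := key hcon.1
  obtain ⟨r, hr, hβr⟩ := key hcon.2
  exact h.not_lt_of_lt hq hαq hβr hr

/-- If `p` and `m` have the same proper initial segment `r` and reach the same second coordinate,
but only `p` advances in the first, then `U ⇒ V` separates them, where `U` and `V` express that the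
first and the second coordinate of `p` have not been reached: `m` reaches the second strictly
before the first, while `p` reaches the first no later than the second. -/
theorem mem_imp_and_notMem_imp (h : JointlyFaithful α β) {p m : Z} (hI : Set.Iio p = Set.Iio m)
    (hα : α m < α p) (hβ : β m = β p) {U V : DualCarrier Z}
    (hU : U.setᶜ = α ⁻¹' Set.Ici (α p)) (hV : V.setᶜ = β ⁻¹' Set.Ici (β p)) :
    p ∈ (U.imp V).set ∧ m ∉ (U.imp V).set := by
  have memU : ∀ x, x ∈ U.set ↔ ¬ α p ≤ α x := fun x => by
    rw [← not_iff_not, not_not]; exact Set.ext_iff.1 hU x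
  have memV : ∀ x, x ∈ V.set ↔ ¬ β p ≤ β x := fun x => by
    rw [← not_iff_not, not_not]; exact Set.ext_iff.1 hV x
  rw [DualCarrier.mem_imp, DualCarrier.mem_imp]
  constructor
  · intro q hq hqU
    rcases hq.eq_or_lt with rfl | hq
    · exact absurd le_rfl ((memU q).1 hqU)
    · rw [memV]
      intro hβq
      obtain ⟨r, hr, hrm⟩ := h.fst_open p (α m) hα.le
      have hrp : r < p := lt_of_le_of_ne hr fun he => hα.ne (by rw [← hrm, he])
      have hrm' : r ∈ Set.Iio m := hI ▸ hrp
      have hqm : q ∈ Set.Iio m := hI ▸ hq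
      exact h.not_lt_of_lt hrm' hrm.ge (hβ.le.trans hβq) hqm
  · intro hm
    exact (memV m).1 (hm m le_rfl ((memU m).2 hα.not_ge)) hβ.ge

variable {A : Set (DualCarrier Z)}

/-- Elements that branch off at the same place are told apart by the first coordinate, by the
second, or by the order in which the two are reached. -/
theorem exists_separating (h : JointlyFaithful α β) (hA : ∀ U ∈ A, ∀ V ∈ A, U.imp V ∈ A)
    (hAα : ∀ s, ∃ U ∈ A, U.setᶜ = α ⁻¹' Set.Ici s) (hAβ : ∀ t, ∃ U ∈ A, U.setᶜ = β ⁻¹' Set.Ici t)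
    {p m : Z} (hI : Set.Iio p = Set.Iio m) (hne : p ≠ m) : ∃ U ∈ A, p ∈ U.set ∧ m ∉ U.set := by
  have key : ∀ {V : HFor.{u}} {γ : Z → V}, (∀ s, ∃ U ∈ A, U.setᶜ = γ ⁻¹' Set.Ici s) →
      ¬ γ m ≤ γ p → ∃ U ∈ A, p ∈ U.set ∧ m ∉ U.set := by
    intro V γ hAγ hγ
    obtain ⟨U, hUA, hU⟩ := hAγ (γ m)
    exact ⟨U, hUA, not_not.1 fun hp => hγ ((Set.ext_iff.1 hU p).1 hp),
      (Set.ext_iff.1 hU m).2 (Set.mem_Ici.2 le_rfl)⟩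
  by_cases hα : α m ≤ α p
  · by_cases hβ : β m ≤ β p
    · obtain ⟨U, hUA, hU⟩ := hAα (α p)
      obtain ⟨V, hVA, hV⟩ := hAβ (β p)
      rcases hα.eq_or_lt with hα' | hα'
      · rcases hβ.eq_or_lt with hβ' | hβ'
        · exact absurd (h.ext p m hI hα'.symm hβ'.symm) hne
        · exact ⟨_, hA V hVA U hUA, h.swap.mem_imp_and_notMem_imp hI hβ' hα' hV hU⟩
      · rcases hβ.eq_or_lt with hβ' | hβ'
        · exact ⟨_, hA U hUA V hVA, h.mem_imp_and_notMem_imp hI hα' hβ' hU hV⟩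
        · -- Both images of `m` would already be reached in the common initial segment.
          obtain ⟨q, hq, hqm⟩ := h.fst_open p _ hα
          obtain ⟨r, hr, hrm⟩ := h.snd_open p _ hβ
          have hqI : q ∈ Set.Iio m :=
            hI ▸ lt_of_le_of_ne hq fun he => hα'.ne (by rw [← hqm, he])
          have hrI : r ∈ Set.Iio m :=
            hI ▸ lt_of_le_of_ne hr fun he => hβ'.ne (by rw [← hrm, he])
          exact absurd hrI (h.not_lt_of_lt hqI hqm.ge hrm.ge)
    · exact key hAβ hβ
  · exact key hAα hα

/-- Complements of cones belong to `A`. The element `p` is minimal in the inverse image of a cone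
under one of the projections, so it suffices to separate it from the other minimal elements `m`.
Where `(m]` leaves `(p]` it either has a shorter initial segment than `p`, and its cone separates
by induction, or branches off exactly at `p`. -/
theorem exists_compl_eq_Ici (h : JointlyFaithful α β) (hA : ∀ U ∈ A, ∀ V ∈ A, U.imp V ∈ A)
    (hAα : ∀ s, ∃ U ∈ A, U.setᶜ = α ⁻¹' Set.Ici s) (hAβ : ∀ t, ∃ U ∈ A, U.setᶜ = β ⁻¹' Set.Ici t)
    (p : Z) : ∃ U ∈ A, U.setᶜ = Set.Ici p := by
  induction hn : (Set.Iio p).ncard using Nat.strong_induction_on generalizing p with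
  | _ n ih =>
  obtain ⟨W, hWA, hpW⟩ : ∃ W ∈ A, Minimal (· ∈ W.setᶜ) p := by
    rcases h.minimal_or_minimal p with hp | hp
    · obtain ⟨W, hWA, hW⟩ := hAα (α p)
      exact ⟨W, hWA, hW ▸ hp⟩
    · obtain ⟨W, hWA, hW⟩ := hAβ (β p)
      exact ⟨W, hWA, hW ▸ hp⟩
  obtain ⟨V, hVA, hV⟩ := exists_compl_eq_upperClosure hA hWA (M := {p})
    (Set.singleton_subset_iff.2 hpW) (fun m hm hmp => by
      have hmp' : ¬ m ≤ p := fun hle => hmp (le_antisymm hle (hpW.2 hm.1 hle))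
      have hpm : ¬ p ≤ m := fun hle => hmp' (hm.2 hpW.1 hle)
      -- the first element of the chain `(m]` at which it leaves `(p]`
      obtain ⟨m', hm'm, hm'⟩ := exists_minimal_le (U := {x | ¬ x ≤ p}) hmp'
      have hsub : Set.Iio m' ⊆ Set.Iio p := fun q hq => by
        refine lt_of_le_of_ne (not_not.1 fun hqp => ?_) fun he => ?_
        · exact (hm'.not_lt hqp) hq
        · exact hpm (he ▸ (le_of_lt hq).trans hm'm)
      obtain ⟨U, hUA, hpU, hm'U⟩ : ∃ U ∈ A, p ∈ U.set ∧ m' ∉ U.set := by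
        rcases hsub.eq_or_ssubset with heq | hss
        · exact h.exists_separating hA hAα hAβ heq.symm fun he => hm'.1 he.ge
        · obtain ⟨U, hUA, hU⟩ := ih _ (hn ▸ Set.ncard_lt_ncard hss) m' rfl
          exact ⟨U, hUA, not_not.1 fun hp => hm'.1 ((Set.ext_iff.1 hU p).1 hp),
            (Set.ext_iff.1 hU m').2 (Set.mem_Ici.2 le_rfl)⟩
      exact ⟨U, hUA, Set.singleton_subset_iff.2 hpU, fun hmU => hm'U (U.lower hmU hm'm)⟩)
  exact ⟨V, hVA, by simpa using hV⟩

end JointlyFaithful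

theorem tensor_jointlyFaithful (X Y : HFor.{u}) :
    JointlyFaithful (F := tensor X Y) (S := X) (T := Y) Tensor.fst Tensor.snd where
  fst_mono := Tensor.fst_mono
  snd_mono := Tensor.snd_mono
  fst_open p s hs := Hom.isOpen (tensorFst X Y) p s hs
  snd_open p s hs := Hom.isOpen (tensorSnd X Y) p s hs
  strict _ _ hqp h₁ h₂ := Tensor.eq_of_le_of_fst_le_of_snd_le hqp h₁ h₂
  ext _ _ hpq h₁ h₂ := Tensor.eq_of_Iio_eq_of_last_eq hpq (Prod.ext h₁ h₂)

/-- The dual algebra of a tensor product is generated by the inverse images of basic sets under the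
two projections. -/
theorem mem_of_tensor_preimage_mem {X Y : HFor.{u}} {A : Set (DualCarrier (tensor X Y))}
    (hA : ∀ U ∈ A, ∀ V ∈ A, U.imp V ∈ A)
    (hAX : ∀ V ∈ X.base, ∃ U ∈ A, U.setᶜ = Tensor.fst ⁻¹' V)
    (hAY : ∀ V ∈ Y.base, ∃ U ∈ A, U.setᶜ = Tensor.snd ⁻¹' V)
    (D : DualCarrier (tensor X Y)) : D ∈ A := by
  have cone := (tensor_jointlyFaithful X Y).exists_compl_eq_Ici hA
    (fun s => hAX _ (X.isHBase.cone_mem s)) (fun t => hAY _ (Y.isHBase.cone_mem t))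
  suffices ∃ V ∈ A, V.setᶜ = D.setᶜ by
    obtain ⟨V, hVA, hV⟩ := this
    exact DualCarrier.ext (compl_injective hV) ▸ hVA
  have upper : ∀ W ∈ A, ∀ M : Set (tensor X Y), M ⊆ {x | Minimal (· ∈ W.setᶜ) x} →
      ∃ V ∈ A, V.setᶜ = upperClosure M := fun W hW M hM =>
    exists_compl_eq_upperClosure hA hW hM fun m hm hmM => by
      obtain ⟨U, hUA, hU⟩ := cone m
      refine ⟨U, hUA, fun x hx => not_not.1 fun hxU => ?_, (Set.ext_iff.1 hU m).2 (Set.mem_Ici.2 le_rfl)⟩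
      have hmx : m ≤ x := (Set.ext_iff.1 hU x).1 hxU
      exact hmM (le_antisymm hmx ((hM hx).2 hm.1 hmx) ▸ hx)
  rcases D.compl_mem with ⟨p, hp⟩ | ⟨V, hV, M, hM, hD⟩ | ⟨V, hV, M, hM, hD⟩
  · obtain ⟨U, hUA, hU⟩ := cone p
    exact ⟨U, hUA, hU.trans hp.symm⟩
  · obtain ⟨W, hWA, hW⟩ := hAX V hV
    rw [hD]
    exact upper W hWA M (hW ▸ hM)
  · obtain ⟨W, hWA, hW⟩ := hAY V hV
    rw [hD]
    exact upper W hWA M (hW ▸ hM)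

end HFor

namespace PHilz

variable {H G K : PHilz.{u}}

theorem generated_inl_inr [Finite H] [Finite G] (d : tensorDual H G) :
    Generated (Set.range (Hom.toFun (inl H G)) ∪ Set.range (Hom.toFun (inr H G))) d := by
  refine HFor.mem_of_tensor_preimage_mem (X := spec H) (Y := spec G)
    (A := {d | Generated (K := tensorDual H G)
      (Set.range (Hom.toFun (inl H G)) ∪ Set.range (Hom.toFun (inr H G))) d})
    (fun U hU V hV => Generated.imp _ _ hU hV) ?_ ?_ d
  · rintro _ ⟨a, rfl⟩
    exact ⟨_, Generated.of _ (Or.inl ⟨a, rfl⟩), rfl⟩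
  · rintro _ ⟨a, rfl⟩
    exact ⟨_, Generated.of _ (Or.inr ⟨a, rfl⟩), rfl⟩

/-! ### The universal property -/

/-- The `u`-succession of pairs of inverse images of the irreducible filters containing `P`. -/
def pairing [Finite H] [Finite G] (f : H ⟶ K) (g : G ⟶ K) (P : Point K) :
    HFor.Tensor (Point H) (Point G) where
  set := (fun Q => (Point.comap f Q, Point.comap g Q)) '' Set.Iic P
  isUSuccession := by
    refine ⟨Set.toFinite _, ?_, ?_⟩
    · rintro _ ⟨Q, hQ, rfl⟩ _ ⟨R, hR, rfl⟩ -
      exact ((point_forest P).total hQ hR).imp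
        (fun h => ⟨Point.comap_mono f h, Point.comap_mono g h⟩)
        (fun h => ⟨Point.comap_mono f h, Point.comap_mono g h⟩)
    · obtain ⟨Q, hQ, hmin⟩ := P.exists_isMin_le
      refine ⟨_, ⟨⟨Q, hQ, rfl⟩, ?_⟩, (Point.isMin_comap f hmin).prodMk (Point.isMin_comap g hmin)⟩
      rintro _ ⟨R, hR, rfl⟩
      have h : Q ≤ R := ((point_forest P).total hQ hR).elim id fun h => hmin h
      exact ⟨Point.comap_mono f h, Point.comap_mono g h⟩
  proj := by
    refine ⟨_, ⟨⟨P, le_refl P, rfl⟩, ?_⟩, ?_, ?_⟩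
    · rintro _ ⟨Q, hQ, rfl⟩
      exact ⟨Point.comap_mono f hQ, Point.comap_mono g hQ⟩
    all_goals
      rw [Set.image_image]
      refine Set.Subset.antisymm ?_ fun R hR => Point.exists_comap_eq _ P hR
      rintro _ ⟨Q, hQ, rfl⟩
      exact Point.comap_mono _ hQ

section Pairing

variable [Finite H] [Finite G] (f : H ⟶ K) (g : G ⟶ K)

theorem last_pairing (P : Point K) :
    (pairing f g P).last = (Point.comap f P, Point.comap g P) := by
  refine (pairing f g P).last_isGreatest.unique ⟨⟨P, le_refl P, rfl⟩, ?_⟩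
  rintro _ ⟨Q, hQ, rfl⟩
  exact ⟨Point.comap_mono f hQ, Point.comap_mono g hQ⟩

theorem pairing_mono : Monotone (pairing f g) := by
  intro Q P hQ
  have h := image_Iic_inter_Iic (φ := fun Q => (Point.comap f Q, Point.comap g Q))
    ((Point.comap_mono f).prodMk (Point.comap_mono g)) (point_forest P) hQ
  refine ⟨h.symm.subset.trans Set.inter_subset_left, fun x hx y hy hyx => ?_⟩
  have hx' := h.symm.subset hx
  exact h.subset ⟨hy, hyx.trans hx'.2⟩

/-- Together with monotonicity: `pairing f g` carries `(P]` onto `(pairing f g P]`. -/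
theorem exists_pairing_eq {P : Point K} {q : HFor.Tensor (Point H) (Point G)}
    (hq : q ≤ pairing f g P) : ∃ Q ≤ P, pairing f g Q = q := by
  obtain ⟨Q, hQ, hlast⟩ := hq.1 q.last_isGreatest.1
  have hl : (pairing f g Q).last = q.last := (last_pairing f g Q).trans hlast
  refine ⟨Q, hQ, ?_⟩
  rcases ((pairing f g P).forest).total hq (pairing_mono f g hQ) with h | h
  · exact (HFor.Tensor.eq_of_le_of_last_le h hl.le).symm
  · exact HFor.Tensor.eq_of_le_of_last_le h hl.ge

/-- Each element `d` of `D(X(H) ⊗ X(G))` names an element of `K`: its inverse image under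
`pairing f g` consists of the irreducible filters to which that element belongs. -/
theorem exists_forall_pairing_mem_iff (d : tensorDual H G) :
    ∃ k : K, ∀ P : Point K, pairing f g P ∈ HFor.DualCarrier.set d ↔ k ∈ P.set := by
  induction generated_inl_inr d with
  | of d hd =>
    rcases hd with ⟨a, rfl⟩ | ⟨a, rfl⟩
    · refine ⟨Hom.toFun f a, fun P => ?_⟩
      change a ∈ (pairing f g P).last.1.set ↔ _
      rw [last_pairing]; rfl
    · refine ⟨Hom.toFun g a, fun P => ?_⟩
      change a ∈ (pairing f g P).last.2.set ↔ _
      rw [last_pairing]; rfl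
  | top => exact ⟨⊤, fun P => iff_of_true trivial P.irreducible.1.1⟩
  | bot => exact ⟨⊥, fun P => iff_of_false id (bot_notMem P)⟩
  | imp a b _ _ iha ihb =>
    obtain ⟨x, hx⟩ := iha
    obtain ⟨y, hy⟩ := ihb
    refine ⟨x ⇨ y, fun P => (HFor.DualCarrier.mem_imp a b _).trans ?_⟩
    rw [Point.imp_mem_iff]
    constructor
    · exact fun h Q hQ hxQ => (hy Q).1 (h _ (pairing_mono f g hQ) ((hx Q).2 hxQ))
    · intro h q hq hqa
      obtain ⟨Q, hQ, rfl⟩ := exists_pairing_eq f g hq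
      exact (hy Q).2 (h Q hQ ((hx Q).1 hqa))

/-- The homomorphism `D(X(H) ⊗ X(G)) ⟶ K` induced by `f` and `g`. -/
noncomputable def copairing : tensorDual H G ⟶ K :=
  have spec := fun d => (exists_forall_pairing_mem_iff f g d).choose_spec
  PHilz.Hom.mk (H := tensorDual H G) (G := K)
    (fun d => (exists_forall_pairing_mem_iff f g d).choose)
    (fun a b => Point.eq_of_forall_mem_iff fun P => by
      rw [← spec, Point.imp_mem_iff]
      refine (HFor.DualCarrier.mem_imp a b _).trans ⟨fun h Q hQ => ?_, fun h q hq => ?_⟩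
      · rw [← spec, ← spec]
        exact h _ (pairing_mono f g hQ)
      · obtain ⟨Q, hQ, rfl⟩ := exists_pairing_eq f g hq
        have := h Q hQ
        rwa [← spec, ← spec] at this)
    (Point.eq_of_forall_mem_iff fun P => by
      rw [← spec]
      exact iff_of_true trivial P.irreducible.1.1)
    (Point.eq_of_forall_mem_iff fun P => by
      rw [← spec]
      exact iff_of_false id (bot_notMem P))

theorem mem_copairing_iff (d : tensorDual H G) (P : Point K) :
    Hom.toFun (copairing f g) d ∈ P.set ↔ pairing f g P ∈ HFor.DualCarrier.set d :=
  ((exists_forall_pairing_mem_iff f g d).choose_spec P).symm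

theorem inl_copairing : inl H G ≫ copairing f g = f := by
  refine Hom.ext (funext fun a => Point.eq_of_forall_mem_iff fun P => ?_)
  refine (mem_copairing_iff f g _ P).trans ?_
  change a ∈ (pairing f g P).last.1.set ↔ _
  rw [last_pairing]; rfl

theorem inr_copairing : inr H G ≫ copairing f g = g := by
  refine Hom.ext (funext fun a => Point.eq_of_forall_mem_iff fun P => ?_)
  refine (mem_copairing_iff f g _ P).trans ?_
  change a ∈ (pairing f g P).last.2.set ↔ _
  rw [last_pairing]; rfl

end Pairing

theorem hom_ext_of_inl_inr [Finite H] [Finite G] {h k : tensorDual H G ⟶ K}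
    (hl : inl H G ≫ h = inl H G ≫ k) (hr : inr H G ≫ h = inr H G ≫ k) : h = k := by
  refine Hom.ext (funext fun d => ?_)
  induction generated_inl_inr d with
  | of d hd =>
    rcases hd with ⟨a, rfl⟩ | ⟨a, rfl⟩
    · exact congrFun (congrArg Hom.toFun hl) a
    · exact congrFun (congrArg Hom.toFun hr) a
  | top => rw [Hom.map_top, Hom.map_top]
  | bot => rw [Hom.map_bot, Hom.map_bot]
  | imp a b _ _ iha ihb => rw [Hom.map_imp, Hom.map_imp, iha, ihb]

end PHilz

theorem mainTheorem10 :
    (∀ (K : PHilz.{u}) (S : Set K), S.Finite → {x : K | PHilz.Generated S x}.Finite) ∧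
      ∀ (H G : PHilz.{u}) [Finite H] [Finite G],
        Finite (PHilz.tensorDual H G) ∧
          Nonempty (IsColimit (BinaryCofan.mk (PHilz.inl H G) (PHilz.inr H G))) := by
  refine ⟨fun K S hS => PHilz.finite_generated hS, fun H G _ _ =>
    ⟨inferInstanceAs (Finite (HFor.DualCarrier _)), ⟨?_⟩⟩⟩
  exact BinaryCofan.IsColimit.mk _ (fun f g => PHilz.copairing f g)
    (fun f g => PHilz.inl_copairing f g) (fun f g => PHilz.inr_copairing f g)
    fun f g m hf hg => PHilz.hom_ext_of_inl_inr (hf.trans (PHilz.inl_copairing f g).symm)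
      (hg.trans (PHilz.inr_copairing f g).symm)
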